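/- Let $\Sigma$ be a finite alphabet and let $T_\Sigma$ be the set of full binary trees $t:\{1,2\}^*\to\Sigma$; for a node $v$ let $t.v$ denote the subtree $w\mapsto t(vw)$. A nondeterministic tree automaton $A=\langle\Sigma,Q,q_I,\mathrm{Tr},\mathrm{rank}\rangle$ has a finite state set $Q$, an initial state $q_I\in Q$, transitions $\mathrm{Tr}\subseteq Q\times\Sigma\times Q\times Q$ and a ranking $\mathrm{rank}:Q\to\omega$. For $q\in Q$, a $q$-run of $A$ on $t$ is a tree $\rho:\{1,2\}^*\to Q$ with $\rho(\varepsilon)=q$ and $(\rho(w),t(w),\rho(w1),\rho(w2))\in\mathrm{Tr}$ for all nodes $w$. A run is accepting if on each infinite path the highest rank occurring infinitely often is even, and $T(A)$ is the set of trees that admit an accepting $q_I$-run. $A$ is a Büchi automaton if all its ranks belong to $\{1,2\}$; states of rank $2$ are then called accepting. A set $L\subseteq T_\Sigma$ is a Büchi language if $L=T(A)$ for some Büchi automaton $A$, and a co-Büchi language if $T_\Sigma\setminus L$ is a Büchi language. A cut is a finite maximal antichain in $\{1,2\}^*$ with respect to the prefix order $\le$; for cuts $X,Y$ write $Y>X$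 if for every $y\in Y$ there is $x\in X$ with $y>x$. For an automaton $A$ and a state $q$, let $K^0_q$ be the set of all $t\in T_\Sigma$ that admit a $q$-run of $A$, and let $K^{n+1}_q$ be the set of all $t$ that admit a $q$-run $\rho$ such that for each cut $X$ there are a cut $X'>X$ and a $q$-run $\rho'$ on $t$ with: (i) $\rho'(w)=\rho(w)$ for every $w$ that is a prefix of (or equal to) an element of $X$; (ii) $\mathrm{rank}(\rho'(v))=2$ for all $v\in X'$; (iii) $t.v\in K^n_{\rho'(v)}$ for all $v\in X'$. **Theorem (Rabin).** (a) The class of Büchi tree languages over $\Sigma$ has the first separation property: for any two disjoint Büchi languages $L_1,L_2\subseteq T_\Sigma$ there is a language $K$ that is both Büchi and co-Büchi with $L_1\subseteq K$ and $K\cap L_2=\emptyset$. (b) More precisely, let $A$ and $B$ be Büchi automata over $\Sigma$ with $n_A$ and $n_B$ states, respectively, such that $T(A)\cap T(B)=\emptyset$, and let $M=2^{n_A\cdot n_B}+1$. Then the language $K^M_{q_I}$ of $A$, where $q_I$ is the initial state of $A$, is both Büchi and co-Büchi, $T(A)\subseteq K^M_{q_I}$, and $K^M_{q_I}\cap T(B)=\emptyset$.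 -/

import Mathlib

/-- Nodes of the full binary tree: finite words over the two directions (`false` = first successor,
`true` = second successor). The tree order is the prefix order `<+:`. -/
abbrev Node : Type := List Bool

/-- `T_Σ`: full binary trees labelled by elements of `α`. -/
abbrev LTree (α : Type*) : Type _ := Node → α

/-- The subtree `t.v` of `t` rooted in `v`. -/
def LTree.subtree {α : Type*} (t : LTree α) (v : Node) : LTree α := fun w => t (v ++ w)

/-- The node `p₀ p₁ … pₙ₋₁` on the infinite path `p`. -/
def pathNode (p : ℕ → Bool) (n : ℕ) : Node := (List.range n).map p

/-- A nondeterministic parity tree automaton with alphabet `α` and state set `Q`. Finiteness of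
`α` and `Q` is required separately, wherever automata are used. -/
structure ParityTreeAutomaton (α Q : Type*) where
  init : Q
  trans : Set (Q × α × Q × Q)
  rank : Q → ℕ

namespace ParityTreeAutomaton

variable {α Q : Type*}

/-- `ρ` is a (not necessarily accepting) run of `A` on `t` starting from the state `q`. -/
def IsRunFrom (A : ParityTreeAutomaton α Q) (q : Q) (t : LTree α) (ρ : LTree Q) : Prop :=
  ρ [] = q ∧ ∀ w : Node, (ρ w, t w, ρ (w ++ [false]), ρ (w ++ [true])) ∈ A.trans

/-- Parity condition on the path `p` of `ρ`: the highest rank occurring infinitely often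
along `p` is even. -/
def IsAcceptingPath (A : ParityTreeAutomaton α Q) (ρ : LTree Q) (p : ℕ → Bool) : Prop :=
  ∃ m : ℕ, Even m ∧ (∃ᶠ n in Filter.atTop, A.rank (ρ (pathNode p n)) = m) ∧
    ∀ᶠ n in Filter.atTop, A.rank (ρ (pathNode p n)) ≤ m

/-- The tree language `T(A)` recognized by `A`. -/
def language (A : ParityTreeAutomaton α Q) : Set (LTree α) :=
  {t | ∃ ρ : LTree Q, A.IsRunFrom A.init t ρ ∧ ∀ p : ℕ → Bool, A.IsAcceptingPath ρ p}

/-- Büchi automata: all ranks are 1 or 2. -/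
def IsBuchi (A : ParityTreeAutomaton α Q) : Prop :=
  ∀ q : Q, A.rank q = 1 ∨ A.rank q = 2

end ParityTreeAutomaton

/-- Büchi tree languages: those recognized by a Büchi automaton with finitely many states. -/
def IsBuchiLanguage {α : Type*} (L : Set (LTree α)) : Prop :=
  ∃ (Q : Type) (_ : Finite Q) (A : ParityTreeAutomaton α Q), A.IsBuchi ∧ A.language = L

/-- Co-Büchi tree languages: the complements of Büchi languages. -/
def IsCoBuchiLanguage {α : Type*} (L : Set (LTree α)) : Prop :=
  IsBuchiLanguage Lᶜ

/-- `K` separates `L` from `M`. -/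
def Separates {X : Type*} (K L M : Set X) : Prop :=
  L ⊆ K ∧ Disjoint K M

/-- The first separation property of a class `C` of subsets of `X`: any two disjoint members
of `C` are separated by a set `K` such that both `K` and its complement belong to `C`. -/
def HasFirstSeparationProperty {X : Type*} (C : Set (Set X)) : Prop :=
  ∀ L ∈ C, ∀ M ∈ C, Disjoint L M → ∃ K : Set X, K ∈ C ∧ Kᶜ ∈ C ∧ Separates K L M

/-- A cut: a finite maximal antichain of nodes with respect to the prefix order. -/
def IsCut (X : Set Node) : Prop :=
  X.Finite ∧ IsMaxAntichain (fun u v : Node => u <+: v) X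

/-- `Y > X`: every node of `Y` lies strictly below some node of `X`. -/
def CutBelow (X Y : Set Node) : Prop :=
  ∀ y ∈ Y, ∃ x ∈ X, x <+: y ∧ x ≠ y

/-- The iterated cut-languages `K^n_q` of the automaton `A`. -/
def ParityTreeAutomaton.cutLanguage {α Q : Type*} (A : ParityTreeAutomaton α Q) :
    ℕ → Q → Set (LTree α)
  | 0, q => {t | ∃ ρ : LTree Q, A.IsRunFrom q t ρ}
  | n + 1, q => {t | ∃ ρ : LTree Q, A.IsRunFrom q t ρ ∧
      ∀ X : Set Node, IsCut X →
        ∃ (X' : Set Node) (ρ' : LTree Q), IsCut X' ∧ CutBelow X X' ∧ A.IsRunFrom q t ρ' ∧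
          (∀ x ∈ X, ∀ w : Node, w <+: x → ρ' w = ρ w) ∧
          (∀ v ∈ X', A.rank (ρ' v) = 2) ∧
          ∀ v ∈ X', t.subtree v ∈ A.cutLanguage n (ρ' v)}

/-! The quantifier over cuts in K^{n+1} reduces to a condition at each node: some q-run visits only
nodes from which A can reach, strictly below and on every path of some run, rank-2 states whose
subtrees lie in the matching K^n (`cutLanguage_succ_eq`). So K^{n+1} is a greatest fixed point with
a least fixed point as parameter, which in turn has K^n as parameter; no fixed point refers back to
an enclosing one. Families that a generalized Büchi automaton can guess at every node are closed
under both kinds of fixed point (`Annotatable.gfp`, `Annotatable.lfp`), and complementation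
exchanges the two kinds. Hence each K^n and its complement are Büchi (`annotatable_cutLanguage`).

An accepting run witnesses membership in every K^n, because bar induction turns "rank 2 recurs on
every path" into finite reachability (`recurrentLanguage_subset_cutLanguage`).

For disjointness, consider the pairs (q, p) such that K^n_q contains a tree accepted by B from p.
These sets decrease with n inside a finite set, so two consecutive ones agree at some n ≤ M. A
common tree is then assembled: follow a run of A witnessing K^{n+1} until B accepts, then head for a
cut of A. At the cut the subtree is in K^n and the pair is compatible, so the subtree may be
exchanged for one in K^{n+1} with an accepting run of B from the same state; repeat. Both automata
accept infinitely often on every path (`exists_mem_inter_of_compatiblePairs_subset`), contradicting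
disjointness if the initial pair was compatible. -/

open Filter


/-! ### Nodes, paths and labellings -/

theorem LTree.subtree_apply_nil {α : Type*} (t : LTree α) (v : Node) : t.subtree v [] = t v := by
  simp [LTree.subtree]

theorem LTree.subtree_subtree {α : Type*} (t : LTree α) (v w : Node) :
    (t.subtree v).subtree w = t.subtree (v ++ w) := by
  funext u; simp [LTree.subtree]

theorem pathNode_succ (p : ℕ → Bool) (n : ℕ) : pathNode p (n + 1) = pathNode p n ++ [p n] := by
  simp [pathNode, List.range_succ]

theorem exists_pathNode_append (w : Node) (p : ℕ → Bool) :
    ∃ p' : ℕ → Bool, ∀ n, pathNode p' (w.length + n) = w ++ pathNode p n := by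
  induction w with
  | nil => exact ⟨p, fun n => by simp⟩
  | cons b w ih =>
    obtain ⟨p', hp'⟩ := ih
    refine ⟨fun n => Nat.casesOn n b p', fun n => ?_⟩
    rw [List.cons_append, ← hp' n, List.length_cons, Nat.add_right_comm]
    simp only [pathNode, List.range_succ_eq_map, List.map_cons, List.map_map]
    rfl

/-- Every infinite path passes infinitely often through the set `S` of nodes. -/
def RecurrentOnPaths (S : Node → Prop) : Prop :=
  ∀ p : ℕ → Bool, ∃ᶠ n in atTop, S (pathNode p n)

theorem RecurrentOnPaths.append {S : Node → Prop} (h : RecurrentOnPaths S) (w : Node) :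
    RecurrentOnPaths fun u => S (w ++ u) := by
  intro p
  obtain ⟨p', hp'⟩ := exists_pathNode_append w p
  rw [frequently_atTop]
  intro n
  obtain ⟨m, hm, hS⟩ := frequently_atTop.1 (h p') (w.length + n)
  obtain ⟨k, rfl⟩ := Nat.exists_eq_add_of_le (le_trans (Nat.le_add_right _ _) hm)
  exact ⟨k, by omega, by simpa only [hp'] using hS⟩

/-- Bar induction along the infinite paths of the binary tree. -/
theorem RecurrentOnPaths.induction {S C : Node → Prop} (hS : RecurrentOnPaths S)
    (base : ∀ w, S w → C w) (step : ∀ w, C (w ++ [false]) → C (w ++ [true]) → C w) (w : Node) :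
    C w := by
  by_contra hw
  -- A failing node has a failing child; following such children gives a path that never meets `S`.
  have hd : ∀ v, ∃ b, ¬ C v → ¬ C (v ++ [b]) := by
    intro v
    by_cases h : C (v ++ [false])
    · exact ⟨true, fun hv h' => hv (step v h h')⟩
    · exact ⟨false, fun _ => h⟩
  choose d hd using hd
  let node : ℕ → Node := fun n => Nat.rec [] (fun _ v => v ++ [d (w ++ v)]) n
  have hnode : ∀ n, pathNode (fun n => d (w ++ node n)) n = node n := by
    intro n
    induction n with
    | zero => rfl
    | succ n ih => rw [pathNode_succ, ih]
  have hbad : ∀ n, ¬ C (w ++ node n) := by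
    intro n
    induction n with
    | zero => simpa [node] using hw
    | succ n ih => simpa [node] using hd _ ih
  obtain ⟨n, hn⟩ := (hS.append w fun n => d (w ++ node n)).exists
  rw [hnode] at hn
  exact hbad n (base _ hn)

/-- A labelling of the binary tree constructed step by step from the root. -/
theorem exists_labelling {X : Type*} (x₀ : X) (next : Node → X → Bool → X) :
    ∃ ρ : LTree X, ρ [] = x₀ ∧ ∀ w b, ρ (w ++ [b]) = next w (ρ w) b :=
  ⟨fun w => List.reverseRecOn w x₀ fun v b x => next v x b, by simp, fun w b => by simp⟩

/-- Dependent choice along the tree. It yields runs from fixed points and the common tree of the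
disjointness argument. -/
theorem exists_labelling_of_step {X : Type*} {Inv : Node → X → Prop}
    {R : Node → X → X → X → Prop} {x₀ : X} (h₀ : Inv [] x₀)
    (step : ∀ w x, Inv w x →
      ∃ y z, Inv (w ++ [false]) y ∧ Inv (w ++ [true]) z ∧ R w x y z) :
    ∃ ρ : LTree X, ρ [] = x₀ ∧ (∀ w, Inv w (ρ w)) ∧
      ∀ w, R w (ρ w) (ρ (w ++ [false])) (ρ (w ++ [true])) := by
  classical
  have step' : ∀ w x, ∃ y z, Inv w x →
      Inv (w ++ [false]) y ∧ Inv (w ++ [true]) z ∧ R w x y z := by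
    intro w x
    by_cases h : Inv w x
    · obtain ⟨y, z, h'⟩ := step w x h
      exact ⟨y, z, fun _ => h'⟩
    · exact ⟨x, x, fun h' => absurd h' h⟩
  choose f g hfg using step'
  obtain ⟨ρ, hρ₀, hρ⟩ := exists_labelling x₀ fun w x b => cond b (g w x) (f w x)
  have hInv : ∀ w, Inv w (ρ w) := by
    intro w
    induction w using List.reverseRecOn with
    | nil => rwa [hρ₀]
    | append_singleton w b ih =>
      rw [hρ]
      cases b
      · exact (hfg w _ ih).1
      · exact (hfg w _ ih).2.1
  refine ⟨ρ, hρ₀, hInv, fun w => ?_⟩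
  simpa [hρ] using (hfg w _ (hInv w)).2.2

/-! ### Fixed points of monotone one-step conditions -/

section FixedPoints

universe u v
variable {α : Type u} {F G : Type v}

/-- A condition `δ f a U S₀ S₁` for the fact `f` to hold at a node labelled `a`, where `U` is the
set of auxiliary facts at the node and `S₀`, `S₁` are the sets of facts at its two successors. -/
abbrev LocalCondition (α : Type u) (F G : Type v) : Type (max u v) :=
  F → α → Set G → Set F → Set F → Prop

namespace LocalCondition

/-- Monotonicity in all set arguments. -/
def Mono (δ : LocalCondition α F G) : Prop :=
  ∀ f a ⦃U U' : Set G⦄ ⦃S S' T T' : Set F⦄, U ⊆ U' → S ⊆ S' → T ⊆ T' →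
    δ f a U S T → δ f a U' S' T'

/-- The dual local condition. -/
def dual (δ : LocalCondition α F G) : LocalCondition α F G :=
  fun f a U S T => ¬ δ f a Uᶜ Sᶜ Tᶜ

theorem Mono.dual {δ : LocalCondition α F G} (h : δ.Mono) : δ.dual.Mono :=
  fun f a _ _ _ _ _ _ hU hS hT hd hd' =>
    hd (h f a (Set.compl_subset_compl.2 hU) (Set.compl_subset_compl.2 hS)
      (Set.compl_subset_compl.2 hT) hd')

/-- One unfolding of a local condition. -/
def step (δ : LocalCondition α F G) (L : G → Set (LTree α)) (S : F → Set (LTree α)) (f : F) :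
    Set (LTree α) :=
  {t | δ f (t []) {g | t ∈ L g} {f' | t.subtree [false] ∈ S f'} {f' | t.subtree [true] ∈ S f'}}

/-- Finite approximations of the least fixed point. -/
def lfpApprox (δ : LocalCondition α F G) (L : G → Set (LTree α)) : ℕ → F → Set (LTree α)
  | 0, _ => ∅
  | k + 1, f => δ.step L (lfpApprox δ L k) f

/-- Finite approximations of the greatest fixed point. -/
def gfpApprox (δ : LocalCondition α F G) (L : G → Set (LTree α)) : ℕ → F → Set (LTree α)
  | 0, _ => Set.univ
  | k + 1, f => δ.step L (gfpApprox δ L k) f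

/-- The least fixed point of a local condition. -/
def lfp (δ : LocalCondition α F G) (L : G → Set (LTree α)) (f : F) : Set (LTree α) :=
  ⋃ k, δ.lfpApprox L k f

/-- The greatest fixed point of a local condition. -/
def gfp (δ : LocalCondition α F G) (L : G → Set (LTree α)) (f : F) : Set (LTree α) :=
  ⋂ k, δ.gfpApprox L k f

variable {δ : LocalCondition α F G} {L : G → Set (LTree α)}

theorem Mono.step_subset (hδ : δ.Mono) {S T : F → Set (LTree α)} (h : ∀ f, S f ⊆ T f) (f : F) :
    δ.step L S f ⊆ δ.step L T f :=
  fun _ ht => hδ _ _ subset_rfl (fun _ hf => h _ hf) (fun _ hf => h _ hf) ht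

theorem Mono.lfpApprox_mono (hδ : δ.Mono) (f : F) : Monotone fun k => δ.lfpApprox L k f := by
  refine monotone_nat_of_le_succ fun k => ?_
  induction k generalizing f with
  | zero => exact Set.empty_subset _
  | succ k ih => exact hδ.step_subset ih f

theorem compl_step (S : F → Set (LTree α)) (f : F) :
    (δ.step L S f)ᶜ = δ.dual.step (fun g => (L g)ᶜ) (fun f => (S f)ᶜ) f := by
  ext t
  simp [step, dual, Set.compl_def]

theorem compl_lfpApprox (k : ℕ) (f : F) :
    (δ.lfpApprox L k f)ᶜ = δ.dual.gfpApprox (fun g => (L g)ᶜ) k f := by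
  induction k generalizing f with
  | zero => simp [lfpApprox, gfpApprox]
  | succ k ih => simp only [lfpApprox, gfpApprox, compl_step, ih]

theorem compl_gfpApprox (k : ℕ) (f : F) :
    (δ.gfpApprox L k f)ᶜ = δ.dual.lfpApprox (fun g => (L g)ᶜ) k f := by
  induction k generalizing f with
  | zero => simp [lfpApprox, gfpApprox]
  | succ k ih => simp only [lfpApprox, gfpApprox, compl_step, ih]

theorem compl_lfp (f : F) : (δ.lfp L f)ᶜ = δ.dual.gfp (fun g => (L g)ᶜ) f := by
  simp [lfp, gfp, Set.compl_iUnion, compl_lfpApprox]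

theorem compl_gfp (f : F) : (δ.gfp L f)ᶜ = δ.dual.lfp (fun g => (L g)ᶜ) f := by
  simp [lfp, gfp, Set.compl_iInter, compl_gfpApprox]

/-- The approximations increase and there are finitely many facts, so one stage serves all facts at
a given tree. This is why ω iterations reach the fixed points. -/
theorem Mono.exists_lfpApprox [Finite F] (hδ : δ.Mono) (t : LTree α) :
    ∃ k, ∀ f, t ∈ δ.lfp L f → t ∈ δ.lfpApprox L k f := by
  have h : ∀ f, ∃ k, t ∈ δ.lfp L f → t ∈ δ.lfpApprox L k f := by
    intro f
    by_cases h : t ∈ δ.lfp L f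
    · obtain ⟨k, hk⟩ := Set.mem_iUnion.1 h
      exact ⟨k, fun _ => hk⟩
    · exact ⟨0, fun h' => absurd h' h⟩
  choose k hk using h
  obtain ⟨K, hK⟩ := (Set.finite_range k).bddAbove
  exact ⟨K, fun f hf => hδ.lfpApprox_mono f (hK ⟨f, rfl⟩) (hk f hf)⟩

theorem Mono.step_lfp_subset [Finite F] (hδ : δ.Mono) (f : F) :
    δ.step L (δ.lfp L) f ⊆ δ.lfp L f := by
  intro t ht
  obtain ⟨k₀, h₀⟩ := hδ.exists_lfpApprox (L := L) (t.subtree [false])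
  obtain ⟨k₁, h₁⟩ := hδ.exists_lfpApprox (L := L) (t.subtree [true])
  refine Set.mem_iUnion.2 ⟨max k₀ k₁ + 1, hδ _ _ subset_rfl (fun f' hf => ?_) (fun f' hf => ?_) ht⟩
  · exact hδ.lfpApprox_mono f' (le_max_left _ _) (h₀ _ hf)
  · exact hδ.lfpApprox_mono f' (le_max_right _ _) (h₁ _ hf)

theorem Mono.gfp_subset_step [Finite F] (hδ : δ.Mono) (f : F) :
    δ.gfp L f ⊆ δ.step L (δ.gfp L) f := by
  rw [← Set.compl_subset_compl, compl_gfp, compl_step]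
  simp only [compl_gfp]
  exact hδ.dual.step_lfp_subset f

end LocalCondition

/-- A family of tree languages is annotatable if some automaton with a generalized Büchi condition
guesses at every node a set of languages containing the subtree at that node: all accepting
runs guess correctly, and on every tree some accepting run guesses completely. -/
def Annotatable (L : G → Set (LTree α)) : Prop :=
  ∃ (Q ι : Type v) (_ : Finite Q) (_ : Finite ι) (Δ : Q → α → Q → Q → Prop) (acc : ι → Set Q)
    (out : Q → Set G),
    (∀ (t : LTree α) (ρ : LTree Q),
      (∀ w, Δ (ρ w) (t w) (ρ (w ++ [false])) (ρ (w ++ [true]))) →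
      (∀ i, RecurrentOnPaths fun w => ρ w ∈ acc i) →
      ∀ w g, g ∈ out (ρ w) → t.subtree w ∈ L g) ∧
    ∀ t : LTree α, ∃ ρ : LTree Q,
      (∀ w, Δ (ρ w) (t w) (ρ (w ++ [false])) (ρ (w ++ [true]))) ∧
      (∀ i, RecurrentOnPaths fun w => ρ w ∈ acc i) ∧
      ∀ w g, t.subtree w ∈ L g → g ∈ out (ρ w)

theorem annotatable_const_univ : Annotatable fun _ : G => (Set.univ : Set (LTree α)) :=
  ⟨PUnit, PEmpty, inferInstance, inferInstance, fun _ _ _ _ => True, fun _ => ∅, fun _ => Set.univ,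
    fun _ _ _ _ _ _ _ => trivial,
    fun _ => ⟨fun _ => PUnit.unit, fun _ => trivial, fun i => i.elim, fun _ _ _ => trivial⟩⟩

theorem annotatable_const_empty : Annotatable fun _ : G => (∅ : Set (LTree α)) :=
  ⟨PUnit, PEmpty, inferInstance, inferInstance, fun _ _ _ _ => True, fun _ => ∅, fun _ => ∅,
    fun _ _ _ _ _ _ h => h.elim,
    fun _ => ⟨fun _ => PUnit.unit, fun _ => trivial, fun i => i.elim, fun _ _ h => h.elim⟩⟩

theorem Annotatable.comp {L : G → Set (LTree α)} (h : Annotatable L) (e : F → G) :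
    Annotatable fun f => L (e f) := by
  obtain ⟨Q, ι, hQ, hι, Δ, acc, out, hs, hc⟩ := h
  refine ⟨Q, ι, hQ, hι, Δ, acc, fun q => e ⁻¹' out q,
    fun t ρ h₁ h₂ w f hf => hs t ρ h₁ h₂ w _ hf, fun t => ?_⟩
  obtain ⟨ρ, h₁, h₂, h₃⟩ := hc t
  exact ⟨ρ, h₁, h₂, fun w f hf => h₃ w _ hf⟩

/-- A greatest fixed point may be unfolded forever, so guessing the facts and checking one unfolding
per node needs no new acceptance set. -/
theorem Annotatable.gfp [Finite F] {δ : LocalCondition α F G} (hδ : δ.Mono)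
    {L : G → Set (LTree α)} (h : Annotatable L) : Annotatable (δ.gfp L) := by
  obtain ⟨Q, ι, hQ, hι, Δ, acc, out, hs, hc⟩ := h
  refine ⟨Q × Set F, ι, inferInstance, hι,
    fun x a y z => Δ x.1 a y.1 z.1 ∧ ∀ f ∈ x.2, δ f a (out x.1) y.2 z.2,
    fun i => {x | x.1 ∈ acc i}, fun x => x.2, fun t ρ h₁ h₂ w f hf => ?_, fun t => ?_⟩
  · have hL := hs t (fun w => (ρ w).1) (fun w => (h₁ w).1) h₂
    refine Set.mem_iInter.2 fun k => ?_
    induction k generalizing w f with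
    | zero => trivial
    | succ k ih =>
      have := (h₁ w).2 f hf
      refine hδ _ _ (fun g hg => hL w g hg) (fun f' hf' => ?_) (fun f' hf' => ?_)
        ((LTree.subtree_apply_nil t w).symm ▸ this)
      · simpa only [Set.mem_ofPred_eq, LTree.subtree_subtree] using ih (w ++ [false]) f' hf'
      · simpa only [Set.mem_ofPred_eq, LTree.subtree_subtree] using ih (w ++ [true]) f' hf'
  · obtain ⟨ρ, h₁, h₂, h₃⟩ := hc t
    refine ⟨fun w => (ρ w, {f | t.subtree w ∈ δ.gfp L f}), fun w => ⟨h₁ w, fun f hf => ?_⟩, h₂,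
      fun w f hf => hf⟩
    have := hδ.gfp_subset_step f hf
    simp only [LocalCondition.step, Set.mem_ofPred_eq, LTree.subtree_apply_nil,
      LTree.subtree_subtree] at this
    exact hδ _ _ (fun g hg => h₃ w g hg) subset_rfl subset_rfl this

/-- Breakpoint construction: besides the guessed facts, a state carries a set of obligations,
refilled from the guessed facts at the next nodes once it is empty. Requiring it to be empty
infinitely often on every path makes the unfolding well-founded. -/
theorem Annotatable.lfp [Finite F] {δ : LocalCondition α F G} (hδ : δ.Mono)
    {L : G → Set (LTree α)} (h : Annotatable L) : Annotatable (δ.lfp L) := by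
  classical
  obtain ⟨Q, ι, hQ, hι, Δ, acc, out, hs, hc⟩ := h
  refine ⟨Q × Set F × Set F, Option ι, inferInstance, inferInstance,
    fun x a y z => Δ x.1 a y.1 z.1 ∧ (∀ f ∈ x.2.1, δ f a (out x.1) y.2.1 z.2.1) ∧
      (∀ f ∈ x.2.2, δ f a (out x.1) y.2.2 z.2.2) ∧
      (x.2.2 = ∅ → y.2.2 = y.2.1 ∧ z.2.2 = z.2.1),
    fun i => i.elim {x | x.2.2 = ∅} fun j => {x | x.1 ∈ acc j}, fun x => x.2.1,
    fun t ρ h₁ h₂ w f hf => ?_, fun t => ?_⟩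
  · have hL := hs t (fun w => (ρ w).1) (fun w => (h₁ w).1) fun i => h₂ (some i)
    have hempty : RecurrentOnPaths fun w => (ρ w).2.2 = ∅ := h₂ none
    have key : ∀ (w : Node) (f : F) (S T : Set F), δ f (t w) (out (ρ w).1) S T →
        (∀ f ∈ S, t.subtree (w ++ [false]) ∈ δ.lfp L f) →
        (∀ f ∈ T, t.subtree (w ++ [true]) ∈ δ.lfp L f) → t.subtree w ∈ δ.lfp L f := by
      intro w f S T hd hS hT
      refine hδ.step_lfp_subset f ?_
      simp only [LocalCondition.step, Set.mem_ofPred_eq, LTree.subtree_apply_nil,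
        LTree.subtree_subtree]
      exact hδ _ _ (fun g hg => hL w g hg) hS hT hd
    -- Obligations come first: they hold vacuously at breakpoints. The guessed facts follow, since
    -- just after a breakpoint they coincide with the obligations.
    have hO : ∀ w, ∀ f ∈ (ρ w).2.2, t.subtree w ∈ δ.lfp L f := by
      refine hempty.induction (fun w hw f hf => ?_) fun w ih₀ ih₁ f hf => ?_
      · rw [hw] at hf
        exact hf.elim
      · exact key w f _ _ ((h₁ w).2.2.1 f hf) ih₀ ih₁
    have hS : ∀ w, ∀ f ∈ (ρ w).2.1, t.subtree w ∈ δ.lfp L f := by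
      refine hempty.induction (fun w hw f hf => ?_) fun w ih₀ ih₁ f hf => ?_
      · obtain ⟨e₀, e₁⟩ := (h₁ w).2.2.2 hw
        exact key w f _ _ ((h₁ w).2.1 f hf) (e₀ ▸ hO _) (e₁ ▸ hO _)
      · exact key w f _ _ ((h₁ w).2.1 f hf) ih₀ ih₁
    exact hS w f hf
  · obtain ⟨ρ, h₁, h₂, h₃⟩ := hc t
    choose N hN using fun v => hδ.exists_lfpApprox (L := L) (t.subtree v)
    let O : Node → ℕ → Set F := fun w k => {f | t.subtree w ∈ δ.lfpApprox L k f}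
    -- A countdown: the obligations are the facts of stage `κ w`. A reset jumps to a stage
    -- containing all facts of the child; otherwise the stage drops by one, so obligations must run
    -- out.
    obtain ⟨κ, -, hκ⟩ := exists_labelling 0 fun w k b => if O w k = ∅ then N (w ++ [b]) else k - 1
    have hunfold : ∀ w f k, t.subtree w ∈ δ.lfpApprox L (k + 1) f →
        δ f (t w) (out (ρ w)) (O (w ++ [false]) k) (O (w ++ [true]) k) := by
      intro w f k hf
      simp only [LocalCondition.lfpApprox, LocalCondition.step, Set.mem_ofPred_eq,
        LTree.subtree_apply_nil, LTree.subtree_subtree] at hf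
      exact hδ _ _ (fun g hg => h₃ w g hg) subset_rfl subset_rfl hf
    have hsub : ∀ w k, O w k ⊆ {f | t.subtree w ∈ δ.lfp L f} :=
      fun w k f hf => Set.mem_iUnion.2 ⟨k, hf⟩
    have hpos : ∀ w, (O w (κ w)).Nonempty → 0 < κ w := by
      rintro w ⟨f, hf⟩
      rcases Nat.eq_zero_or_pos (κ w) with h | h
      · rw [h] at hf
        exact hf.elim
      · exact h
    refine ⟨fun w => (ρ w, {f | t.subtree w ∈ δ.lfp L f}, O w (κ w)),
      fun w => ⟨h₁ w, fun f hf => ?_, fun f hf => ?_, fun hw => ?_⟩, fun i => ?_,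
      fun w f hf => hf⟩
    · obtain ⟨k, hk⟩ := Set.mem_iUnion.1 hf
      exact hδ _ _ subset_rfl (hsub _ _) (hsub _ _)
        (hunfold w f k (hδ.lfpApprox_mono f (Nat.le_succ k) hk))
    · have hne : (O w (κ w)).Nonempty := ⟨f, hf⟩
      have hp := hpos w hne
      have hf' : t.subtree w ∈ δ.lfpApprox L (κ w - 1 + 1) f := by
        rwa [Nat.sub_add_cancel hp]
      simpa only [hκ, if_neg hne.ne_empty] using hunfold w f _ hf'
    · have : ∀ b, O (w ++ [b]) (κ (w ++ [b])) = {f | t.subtree (w ++ [b]) ∈ δ.lfp L f} := by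
        intro b
        refine (hsub _ _).antisymm fun f hf => ?_
        rw [hκ, if_pos hw]
        exact hN _ f hf
      exact ⟨this false, this true⟩
    · cases i with
      | some i => exact h₂ i
      | none =>
        intro p
        change ∃ᶠ n in atTop, O (pathNode p n) (κ (pathNode p n)) = ∅
        by_contra hcon
        rw [not_frequently, eventually_atTop] at hcon
        obtain ⟨n, hn⟩ := hcon
        have hdec : ∀ j, κ (pathNode p (n + j)) + j ≤ κ (pathNode p n) := by
          intro j
          induction j with
          | zero => rfl
          | succ j ih =>
            have hj := hn (n + j) (Nat.le_add_right _ _)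
            have := hpos _ (Set.nonempty_iff_ne_empty.2 hj)
            have hs : κ (pathNode p (n + (j + 1))) = κ (pathNode p (n + j)) - 1 := by
              rw [← add_assoc, pathNode_succ, hκ, if_neg hj]
            omega
        have := hdec (κ (pathNode p n) + 1)
        omega

end FixedPoints


/-! ### From annotatable families to Büchi automata -/

theorem ParityTreeAutomaton.IsBuchi.isAcceptingPath_iff {α Q : Type*}
    {A : ParityTreeAutomaton α Q} (hA : A.IsBuchi) (ρ : LTree Q) (p : ℕ → Bool) :
    A.IsAcceptingPath ρ p ↔ ∃ᶠ n in atTop, A.rank (ρ (pathNode p n)) = 2 := by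
  constructor
  · rintro ⟨m, hm, hfreq, -⟩
    obtain ⟨n, hn⟩ := hfreq.exists
    have : m = 2 := by
      rcases hA (ρ (pathNode p n)) with h | h
      · rw [← hn, h] at hm
        exact absurd hm (by decide)
      · omega
    exact this ▸ hfreq
  · intro h
    refine ⟨2, by decide, h, Eventually.of_forall fun n => ?_⟩
    rcases hA (ρ (pathNode p n)) with h | h <;> omega

theorem ParityTreeAutomaton.IsBuchi.forall_isAcceptingPath_iff {α Q : Type*}
    {A : ParityTreeAutomaton α Q} (hA : A.IsBuchi) (ρ : LTree Q) :
    (∀ p, A.IsAcceptingPath ρ p) ↔ RecurrentOnPaths fun w => A.rank (ρ w) = 2 :=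
  forall_congr' fun p => hA.isAcceptingPath_iff ρ p

/-- Finiteness of the state set suffices for a Büchi language, whatever its universe. -/
theorem ParityTreeAutomaton.IsBuchi.isBuchiLanguage {α Q : Type*} [Finite Q]
    {A : ParityTreeAutomaton α Q} (hA : A.IsBuchi) : IsBuchiLanguage A.language := by
  obtain ⟨n, ⟨e⟩⟩ := Finite.exists_equiv_fin Q
  refine ⟨Fin n, inferInstance,
    ⟨e A.init, {x | (e.symm x.1, x.2.1, e.symm x.2.2.1, e.symm x.2.2.2) ∈ A.trans},
      fun x => A.rank (e.symm x)⟩, fun x => hA _, ?_⟩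
  ext t
  constructor
  · rintro ⟨ρ, ⟨hρ₀, hρ⟩, hacc⟩
    exact ⟨fun w => e.symm (ρ w), ⟨by simp [hρ₀], hρ⟩, hacc⟩
  · rintro ⟨ρ, ⟨hρ₀, hρ⟩, hacc⟩
    refine ⟨fun w => e (ρ w), ⟨by simp [hρ₀], fun w => ?_⟩, fun p => ?_⟩
    · simpa using hρ w
    · simpa [IsAcceptingPath] using hacc p

open Classical in
/-- The acceptance sets still to be visited, after reading a state in the acceptance sets `V`. -/
noncomputable def pendingUpdate {ι : Type*} (R V : Set ι) : Set ι :=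
  (if R = ∅ then Set.univ else R) \ V

/-- If `i` were eventually never visited, it would stay pending forever after the next refill. -/
theorem recurrent_of_pending_empty {ι : Type*} {R V : ℕ → Set ι}
    (hR : ∀ n, R (n + 1) = pendingUpdate (R n) (V (n + 1)))
    (h : ∃ᶠ n in atTop, R n = ∅) (i : ι) : ∃ᶠ n in atTop, i ∈ V n := by
  by_contra hcon
  rw [not_frequently, eventually_atTop] at hcon
  obtain ⟨n, hn⟩ := hcon
  obtain ⟨m, hm, hRm⟩ := frequently_atTop.1 h n
  obtain ⟨m', hm', hRm'⟩ := frequently_atTop.1 h (m + 1)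
  have key : ∀ j, i ∈ R (m + 1 + j) := by
    intro j
    induction j with
    | zero =>
      rw [add_zero, hR, pendingUpdate, if_pos hRm]
      exact ⟨trivial, hn _ (by omega)⟩
    | succ j ih =>
      rw [← add_assoc, hR, pendingUpdate, if_neg (Set.nonempty_iff_ne_empty.1 ⟨i, ih⟩)]
      exact ⟨ih, hn _ (by omega)⟩
  have := key (m' - (m + 1))
  rw [Nat.add_sub_cancel' hm', hRm'] at this
  exact this

/-- Without further refills the pending set only shrinks, and each of the finitely many indices
eventually leaves it. -/
theorem pending_empty_of_recurrent {ι : Type*} [Finite ι] {R V : ℕ → Set ι}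
    (hR : ∀ n, R (n + 1) = pendingUpdate (R n) (V (n + 1)))
    (h : ∀ i, ∃ᶠ n in atTop, i ∈ V n) : ∃ᶠ n in atTop, R n = ∅ := by
  by_contra hcon
  rw [not_frequently, eventually_atTop] at hcon
  obtain ⟨n, hn⟩ := hcon
  have hsucc : ∀ m, n ≤ m → R (m + 1) = R m \ V (m + 1) := by
    intro m hm
    rw [hR, pendingUpdate, if_neg (hn m hm)]
  have hanti : ∀ m, n ≤ m → ∀ j, R (m + j) ⊆ R m := by
    intro m hm j
    induction j with
    | zero => rfl
    | succ j ih =>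
      rw [← add_assoc, hsucc _ (by omega)]
      exact Set.sdiff_subset.trans ih
  have hleave : ∀ i, ∃ m, n ≤ m ∧ i ∉ R m := by
    intro i
    obtain ⟨m, hm, hi⟩ := frequently_atTop.1 (h i) (n + 1)
    obtain ⟨k, rfl⟩ := Nat.exists_eq_add_of_le' (show 1 ≤ m by omega)
    exact ⟨k + 1, by omega, by rw [hsucc k (by omega)]; exact fun h => h.2 hi⟩
  choose m hm hi using hleave
  obtain ⟨K, hK⟩ := (Set.finite_range m).bddAbove
  refine hn (max n K) (le_max_left _ _) (Set.eq_empty_of_forall_notMem fun i hiR => hi i ?_)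
  have hle : m i ≤ max n K := (hK ⟨i, rfl⟩).trans (le_max_right _ _)
  have := hanti (m i) (hm i) (max n K - m i)
  rw [Nat.add_sub_cancel' hle] at this
  exact this hiR

open Classical in
/-- The Büchi automaton, with a new initial state `none`, that runs a generalized Büchi automaton
from all states in `I` and remembers the acceptance sets still to be visited. -/
noncomputable def degeneralization {α Q ι : Type*} (Δ : Q → α → Q → Q → Prop) (acc : ι → Set Q)
    (I : Set Q) : ParityTreeAutomaton α (Option (Q × Set ι)) where
  init := none
  trans := {x | ∃ q R y z,
    (x.1 = some (q, R) ∨ x.1 = none ∧ q ∈ I ∧ R = ∅) ∧ Δ q x.2.1 y z ∧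
      x.2.2.1 = some (y, pendingUpdate R {i | y ∈ acc i}) ∧
      x.2.2.2 = some (z, pendingUpdate R {i | z ∈ acc i})}
  rank x := x.elim 1 fun s => if s.2 = ∅ then 2 else 1

theorem isBuchi_degeneralization {α Q ι : Type*} (Δ : Q → α → Q → Q → Prop) (acc : ι → Set Q)
    (I : Set Q) : (degeneralization Δ acc I).IsBuchi := by
  rintro (_ | ⟨q, R⟩)
  · exact Or.inl rfl
  · by_cases h : R = ∅
    · exact Or.inr (if_pos h)
    · exact Or.inl (if_neg h)

theorem rank_degeneralization_some {α Q ι : Type*} (Δ : Q → α → Q → Q → Prop) (acc : ι → Set Q)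
    (I : Set Q) (s : Q × Set ι) : (degeneralization Δ acc I).rank (some s) = 2 ↔ s.2 = ∅ := by
  by_cases h : s.2 = ∅ <;> simp [degeneralization, h]

theorem language_degeneralization {α Q ι : Type*} [Finite ι] (Δ : Q → α → Q → Q → Prop)
    (acc : ι → Set Q) (I : Set Q) :
    (degeneralization Δ acc I).language = {t | ∃ ρ : LTree Q, ρ [] ∈ I ∧
      (∀ w, Δ (ρ w) (t w) (ρ (w ++ [false])) (ρ (w ++ [true]))) ∧
      ∀ i, RecurrentOnPaths fun w => ρ w ∈ acc i} := by
  ext t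
  constructor
  · rintro ⟨σ, ⟨hσ₀, hσ⟩, hacc⟩
    rw [(isBuchi_degeneralization Δ acc I).forall_isAcceptingPath_iff] at hacc
    have hcons : ∀ w, ∃ s : Q × Set ι, (σ w = some s ∨ w = [] ∧ s.1 ∈ I ∧ s.2 = ∅) ∧
        ∃ y z, Δ s.1 (t w) y z ∧
        σ (w ++ [false]) = some (y, pendingUpdate s.2 {i | y ∈ acc i}) ∧
        σ (w ++ [true]) = some (z, pendingUpdate s.2 {i | z ∈ acc i}) := by
      intro w
      obtain ⟨q, R, y, z, h, hΔ, hy, hz⟩ := hσ w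
      refine ⟨(q, R), ?_, y, z, hΔ, hy, hz⟩
      rcases h with h | ⟨hnone, h⟩
      · exact Or.inl h
      -- Only the root can carry `none`, because targets of transitions are always `some`.
      · rcases List.eq_nil_or_concat' w with rfl | ⟨v, b, rfl⟩
        · exact Or.inr ⟨rfl, h⟩
        · obtain ⟨_, _, _, _, _, _, hy', hz'⟩ := hσ v
          cases b
          · exact absurd (hnone.symm.trans hy') (by simp)
          · exact absurd (hnone.symm.trans hz') (by simp)
    choose s hs y z hΔ hy hz using hcons
    have hsome : ∀ w b, σ (w ++ [b]) = some (s (w ++ [b])) := by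
      intro w b
      rcases hs (w ++ [b]) with h | ⟨h, -⟩
      · exact h
      · simp at h
    have hy' : ∀ w, s (w ++ [false]) = (y w, pendingUpdate (s w).2 {i | y w ∈ acc i}) :=
      fun w => Option.some_injective _ ((hsome w false).symm.trans (hy w))
    have hz' : ∀ w, s (w ++ [true]) = (z w, pendingUpdate (s w).2 {i | z w ∈ acc i}) :=
      fun w => Option.some_injective _ ((hsome w true).symm.trans (hz w))
    refine ⟨fun w => (s w).1, ?_, fun w => by simpa [hy', hz'] using hΔ w, fun i p => ?_⟩
    · rcases hs [] with h | ⟨-, h, -⟩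
      · exact absurd (hσ₀.symm.trans h) (by simp [degeneralization])
      · exact h
    · refine recurrent_of_pending_empty (R := fun n => (s (pathNode p n)).2)
        (V := fun n => {i | (s (pathNode p n)).1 ∈ acc i}) (fun n => ?_) ?_ i
      · simp only [pathNode_succ]
        cases p n
        · simp [hy']
        · simp [hz']
      · refine ((hacc p).and_eventually (eventually_gt_atTop 0)).mono fun n hn => ?_
        obtain ⟨m, rfl⟩ := Nat.exists_eq_add_of_le' hn.2
        have := hn.1
        rw [pathNode_succ, hsome, rank_degeneralization_some] at this
        rw [pathNode_succ]
        exact this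
  · rintro ⟨ρ, hI, hΔ, hacc⟩
    obtain ⟨R, hR₀, hR⟩ := exists_labelling (∅ : Set ι)
      fun w R b => pendingUpdate R {i | ρ (w ++ [b]) ∈ acc i}
    refine ⟨fun w => if w = [] then none else some (ρ w, R w), ⟨by simp [degeneralization],
      fun w => ⟨ρ w, R w, ρ (w ++ [false]), ρ (w ++ [true]), ?_, hΔ w, ?_, ?_⟩⟩, ?_⟩
    · by_cases hw : w = []
      · subst hw
        exact Or.inr ⟨by simp, hI, hR₀⟩
      · exact Or.inl (by simp [hw])
    · simp [hR]
    · simp [hR]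
    · rw [(isBuchi_degeneralization Δ acc I).forall_isAcceptingPath_iff]
      intro p
      have : ∃ᶠ n in atTop, R (pathNode p n) = ∅ :=
        pending_empty_of_recurrent (R := fun n => R (pathNode p n))
          (V := fun n => {i | ρ (pathNode p n) ∈ acc i})
          (fun n => by simp only [pathNode_succ, hR]) fun i => hacc i p
      refine (this.and_eventually (eventually_gt_atTop 0)).mono fun n hn => ?_
      obtain ⟨m, rfl⟩ := Nat.exists_eq_add_of_le' hn.2
      have hne : pathNode p (m + 1) ≠ [] := by simp [pathNode_succ]
      rw [if_neg hne, rank_degeneralization_some]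
      exact hn.1

/-- Start the annotating automaton in the states that claim `g` at the root, and degeneralize. -/
theorem Annotatable.isBuchiLanguage {α G : Type*} {L : G → Set (LTree α)} (h : Annotatable L)
    (g : G) : IsBuchiLanguage (L g) := by
  obtain ⟨Q, ι, hQ, hι, Δ, acc, out, hs, hc⟩ := h
  have hL : L g = (degeneralization Δ acc {q | g ∈ out q}).language := by
    rw [language_degeneralization]
    ext t
    constructor
    · intro ht
      obtain ⟨ρ, h₁, h₂, h₃⟩ := hc t
      exact ⟨ρ, h₃ [] g ht, h₁, h₂⟩
    · rintro ⟨ρ, h₀, h₁, h₂⟩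
      exact hs t ρ h₁ h₂ [] g h₀
  rw [hL]
  exact (isBuchi_degeneralization _ _ _).isBuchiLanguage


/-! ### Cuts -/

theorem isCut_iff {X : Set Node} : IsCut X ↔ X.Finite ∧ IsAntichain (fun u v : Node => u <+: v) X ∧
    ∀ v, ∃ x ∈ X, x <+: v ∨ v <+: x := by
  refine and_congr_right fun _ => ⟨fun h => ⟨h.1, fun v => ?_⟩, fun h => ⟨h.1, fun Y hY hXY => ?_⟩⟩
  · by_contra hv
    push Not at hv
    have hins : IsAntichain (fun u v : Node => u <+: v) (insert v X) :=
      h.1.insert (fun x hx _ => (hv x hx).1) fun x hx _ => (hv x hx).2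
    have hvX : v ∈ X := (h.2 hins (Set.subset_insert v X)).symm ▸ Set.mem_insert v X
    exact (hv v hvX).1 (List.prefix_refl v)
  · refine hXY.antisymm fun v hvY => ?_
    obtain ⟨x, hx, hxv⟩ := h.2 v
    rcases hxv with hxv | hxv
    · exact (hY.eq (hXY hx) hvY hxv) ▸ hx
    · exact (hY.eq hvY (hXY hx) hxv) ▸ hx

theorem IsCut.antichain {X : Set Node} (h : IsCut X) : IsAntichain (fun u v : Node => u <+: v) X :=
  (isCut_iff.1 h).2.1

theorem IsCut.exists_comparable {X : Set Node} (h : IsCut X) (v : Node) :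
    ∃ x ∈ X, x <+: v ∨ v <+: x :=
  (isCut_iff.1 h).2.2 v

theorem isCut_level (n : ℕ) : IsCut {v : Node | v.length = n} := by
  refine isCut_iff.2 ⟨List.finite_length_eq Bool n, fun u hu v hv hne h => ?_, fun v => ?_⟩
  · exact hne (h.eq_of_length (hu.trans hv.symm))
  · rcases le_total n v.length with h | h
    · exact ⟨v.take n, by simpa using h, Or.inl (List.take_prefix n v)⟩
    · exact ⟨v ++ List.replicate (n - v.length) false, by simp [Nat.add_sub_cancel' h],
        Or.inr (List.prefix_append _ _)⟩

theorem isCut_singleton_nil : IsCut {([] : Node)} := by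
  refine isCut_iff.2 ⟨Set.finite_singleton _, IsAntichain.singleton, fun v => ?_⟩
  exact ⟨[], rfl, Or.inl List.nil_prefix⟩

theorem IsAntichain.eq_of_prefix {X : Set Node} (h : IsAntichain (fun u v : Node => u <+: v) X)
    {x y w : Node} (hx : x ∈ X) (hy : y ∈ X) (hxw : x <+: w) (hyw : y <+: w) : x = y := by
  rcases List.prefix_or_prefix_of_prefix hxw hyw with h' | h'
  · exact h.eq hx hy h'
  · exact (h.eq hy hx h').symm

/-- Grafting a cut below each node of a cut; this produces the cuts `X'` demanded by K^{n+1}. -/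
theorem IsCut.bind {X : Set Node} {Y : Node → Set Node} (hX : IsCut X)
    (hY : ∀ x ∈ X, IsCut (Y x)) : IsCut {v | ∃ x ∈ X, ∃ u ∈ Y x, x ++ u = v} := by
  refine isCut_iff.2 ⟨?_, ?_, fun v => ?_⟩
  · have : {v | ∃ x ∈ X, ∃ u ∈ Y x, x ++ u = v} = ⋃ x ∈ X, (fun u => x ++ u) '' Y x := by
      ext v; simp
    rw [this]
    exact hX.1.biUnion fun x hx => (hY x hx).1.image _
  · rintro _ ⟨x, hx, u, hu, rfl⟩ _ ⟨y, hy, v, hv, rfl⟩ hne h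
    have hxy : x = y := hX.antichain.eq_of_prefix hx hy
      ((List.prefix_append x u).trans h) (List.prefix_append y v)
    subst hxy
    exact hne (congrArg _ ((hY x hx).antichain.eq hu hv ((List.prefix_append_right_inj x).1 h)))
  · obtain ⟨x, hx, h | h⟩ := hX.exists_comparable v
    · obtain ⟨v', rfl⟩ := h
      obtain ⟨u, hu, h'⟩ := (hY x hx).exists_comparable v'
      refine ⟨x ++ u, ⟨x, hx, u, hu, rfl⟩, ?_⟩
      simpa only [List.prefix_append_right_inj] using h'
    · obtain ⟨u, hu, -⟩ := (hY x hx).exists_comparable []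
      exact ⟨x ++ u, ⟨x, hx, u, hu, rfl⟩, Or.inr (h.trans (List.prefix_append x u))⟩

/-! ### Cut languages as nested fixed points -/

namespace ParityTreeAutomaton

universe u v
variable {α : Type u} {Q : Type v}

theorem IsRunFrom.subtree {A : ParityTreeAutomaton α Q} {q : Q} {t : LTree α} {ρ : LTree Q}
    (h : A.IsRunFrom q t ρ) (v : Node) : A.IsRunFrom (ρ v) (t.subtree v) (ρ.subtree v) :=
  ⟨ρ.subtree_apply_nil v, fun w => by simpa [LTree.subtree] using h.2 (v ++ w)⟩

/-- Below an antichain a run may be replaced freely. The labelling `ρ` has to respect transitions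
only at nodes not below `X`, so partial runs are allowed. -/
theorem exists_glued_run {A : ParityTreeAutomaton α Q} {X : Set Node}
    (hX : IsAntichain (fun u v : Node => u <+: v) X) {q : Q} {t : LTree α} {ρ : LTree Q}
    {σ : Node → LTree Q} (h₀ : ρ [] = q)
    (hρ : ∀ w, (∀ x ∈ X, ¬ x <+: w) →
      (ρ w, t w, ρ (w ++ [false]), ρ (w ++ [true])) ∈ A.trans)
    (hσ : ∀ x ∈ X, A.IsRunFrom (ρ x) (t.subtree x) (σ x)) :
    ∃ ρ' : LTree Q, A.IsRunFrom q t ρ' ∧ (∀ w, (∀ x ∈ X, x <+: w → x = w) → ρ' w = ρ w) ∧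
      ∀ x ∈ X, ∀ u, ρ' (x ++ u) = σ x u := by
  classical
  let ρ' : LTree Q := fun w =>
    if h : ∃ x ∈ X, x <+: w then σ h.choose (w.drop h.choose.length) else ρ w
  have hin : ∀ x ∈ X, ∀ u, ρ' (x ++ u) = σ x u := by
    intro x hx u
    have h : ∃ y ∈ X, y <+: x ++ u := ⟨x, hx, List.prefix_append x u⟩
    have hy : h.choose = x :=
      hX.eq_of_prefix h.choose_spec.1 hx h.choose_spec.2 (List.prefix_append x u)
    simp only [ρ', dif_pos h, hy, List.drop_left]
  have hout : ∀ w, (∀ x ∈ X, x <+: w → x = w) → ρ' w = ρ w := by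
    intro w hw
    by_cases h : ∃ x ∈ X, x <+: w
    · obtain ⟨x, hx, hxw⟩ := h
      obtain rfl := hw x hx hxw
      simpa [(hσ x hx).1] using hin x hx []
    · exact dif_neg h
  refine ⟨ρ', ⟨?_, fun w => ?_⟩, hout, hin⟩
  · rw [hout, h₀]
    exact fun x _ hx => List.prefix_nil.1 hx
  · by_cases h : ∃ x ∈ X, x <+: w
    · obtain ⟨x, hx, u, rfl⟩ := h
      rw [List.append_assoc, List.append_assoc, hin x hx, hin x hx, hin x hx]
      exact (hσ x hx).2 u
    · push Not at h
      have hchild : ∀ b, ρ' (w ++ [b]) = ρ (w ++ [b]) := fun b => hout _ fun x hx hxw =>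
        (List.prefix_concat_iff.1 hxw).resolve_right (h x hx)
      rw [hout w fun x hx hxw => absurd hxw (h x hx), hchild, hchild]
      exact hρ w h

/-- The local condition of reaching, along all paths of some partial run, states `q` of rank `2`
with `q` in the auxiliary set; for the facts `(q, true)` the root itself does not count. -/
def reachCondition (A : ParityTreeAutomaton α Q) : LocalCondition α (Q × Bool) Q :=
  fun f a U S T => (f.2 = false ∧ A.rank f.1 = 2 ∧ f.1 ∈ U) ∨
    ∃ x y, (f.1, a, x, y) ∈ A.trans ∧ (x, false) ∈ S ∧ (y, false) ∈ T

/-- The local condition of having a run with all its states in the auxiliary sets. -/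
def safeCondition (A : ParityTreeAutomaton α Q) : LocalCondition α Q Q :=
  fun q a U S T => q ∈ U ∧ ∃ x y, (q, a, x, y) ∈ A.trans ∧ x ∈ S ∧ y ∈ T

theorem mono_reachCondition (A : ParityTreeAutomaton α Q) : A.reachCondition.Mono := by
  rintro f a U U' S S' T T' hU hS hT (⟨h₁, h₂, h₃⟩ | ⟨x, y, h, hx, hy⟩)
  · exact Or.inl ⟨h₁, h₂, hU h₃⟩
  · exact Or.inr ⟨x, y, h, hS hx, hT hy⟩

theorem mono_safeCondition (A : ParityTreeAutomaton α Q) : A.safeCondition.Mono := by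
  rintro f a U U' S S' T T' hU hS hT ⟨h₀, x, y, h, hx, hy⟩
  exact ⟨hU h₀, x, y, h, hS hx, hT hy⟩

theorem gfp_safeCondition [Finite Q] (A : ParityTreeAutomaton α Q) (L : Q → Set (LTree α)) (q : Q) :
    A.safeCondition.gfp L q =
      {t | ∃ ρ : LTree Q, A.IsRunFrom q t ρ ∧ ∀ w, t.subtree w ∈ L (ρ w)} := by
  ext t
  constructor
  · intro ht
    obtain ⟨ρ, hρ₀, hInv, hρ⟩ := exists_labelling_of_step
      (Inv := fun w x => t.subtree w ∈ A.safeCondition.gfp L x)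
      (R := fun w x y z => (x, t w, y, z) ∈ A.trans) ht (fun w x hx => by
        obtain ⟨-, y, z, h, hy, hz⟩ := A.mono_safeCondition.gfp_subset_step x hx
        simp only [LTree.subtree_apply_nil, Set.mem_ofPred_eq, LTree.subtree_subtree] at h hy hz
        exact ⟨y, z, hy, hz, h⟩)
    exact ⟨ρ, ⟨hρ₀, hρ⟩, fun w => (A.mono_safeCondition.gfp_subset_step _ (hInv w)).1⟩
  · rintro ⟨ρ, hρ, hL⟩
    refine Set.mem_iInter.2 fun k => ?_
    induction k generalizing q t ρ with
    | zero => trivial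
    | succ k ih =>
      refine ⟨hρ.1 ▸ hL [], ρ [false], ρ [true], hρ.1 ▸ hρ.2 [],
        ih _ _ _ (hρ.subtree _) fun w => ?_, ih _ _ _ (hρ.subtree _) fun w => ?_⟩
      · rw [LTree.subtree_subtree]
        exact hL _
      · rw [LTree.subtree_subtree]
        exact hL _

/-- Each unfolding either stops at the root or takes a transition and grafts the cuts of the two
children. The assumption `hL` extends the partial run past the cut to the whole tree. -/
theorem exists_cut_of_mem_lfpApprox {A : ParityTreeAutomaton α Q} {L : Q → Set (LTree α)}
    (hL : ∀ q, ∀ t ∈ L q, ∃ ρ, A.IsRunFrom q t ρ) (k : ℕ) (f : Q × Bool) (t : LTree α)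
    (ht : t ∈ A.reachCondition.lfpApprox L k f) :
    ∃ (Y : Set Node) (ρ : LTree Q), IsCut Y ∧ A.IsRunFrom f.1 t ρ ∧
      (∀ v ∈ Y, A.rank (ρ v) = 2) ∧ (∀ v ∈ Y, t.subtree v ∈ L (ρ v)) ∧
      (f.2 = true → [] ∉ Y) := by
  induction k generalizing f t with
  | zero => exact ht.elim
  | succ k ih =>
    rcases ht with ⟨hf, hr, ht⟩ | ⟨x, y, h, hx, hy⟩
    · obtain ⟨ρ, hρ⟩ := hL _ t ht
      refine ⟨{[]}, ρ, isCut_singleton_nil, hρ, ?_, ?_, by simp [hf]⟩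
      · rintro _ rfl
        rw [hρ.1, hr]
      · rintro _ rfl
        rw [hρ.1]
        exact ht
    · have hc : ∀ v : Node, v.length = 1 → ∃ (Y : Set Node) (ρ : LTree Q), IsCut Y ∧
          A.IsRunFrom (if v = [true] then y else x) (t.subtree v) ρ ∧
          (∀ u ∈ Y, A.rank (ρ u) = 2) ∧ ∀ u ∈ Y, (t.subtree v).subtree u ∈ L (ρ u) := by
        intro v hv
        obtain ⟨b, rfl⟩ := List.length_eq_one_iff.1 hv
        cases b
        · obtain ⟨Y, ρ, h₁, h₂, h₃, h₄, -⟩ := ih _ _ hx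
          exact ⟨Y, ρ, h₁, h₂, h₃, h₄⟩
        · obtain ⟨Y, ρ, h₁, h₂, h₃, h₄, -⟩ := ih _ _ hy
          exact ⟨Y, ρ, h₁, h₂, h₃, h₄⟩
      have : Nonempty (LTree Q) := ⟨fun _ => x⟩
      choose! Y σ hY hσ hr hσL using hc
      -- Only the values at the root and its two children matter; elsewhere the labelling is
      -- overwritten.
      obtain ⟨ρ', hρ', -, hglue⟩ := exists_glued_run (A := A) (t := t) (q := f.1) (σ := σ)
        (ρ := fun w => if w = [] then f.1 else if w = [true] then y else x)
        (isCut_level 1).antichain (by simp) (fun w hw => by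
          cases w with
          | nil => simpa using h
          | cons b w => exact absurd (List.prefix_append [b] w) (hw [b] (by simp))) (fun v hv => by
          have hne : v ≠ [] := by rintro rfl; simp at hv
          simpa only [if_neg hne] using hσ v hv)
      refine ⟨_, ρ', (isCut_level 1).bind hY, hρ', ?_, ?_, ?_⟩
      · rintro _ ⟨v, hv, u, hu, rfl⟩
        rw [hglue v hv]
        exact hr v hv u hu
      · rintro _ ⟨v, hv, u, hu, rfl⟩
        rw [hglue v hv, ← LTree.subtree_subtree]
        exact hσL v hv u hu
      · rintro - ⟨v, hv, u, hu, h⟩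
        rw [(List.append_eq_nil_iff.1 h).1] at hv
        simp at hv

theorem step_lfp_reachCondition [Finite Q] {A : ParityTreeAutomaton α Q} {L : Q → Set (LTree α)}
    {t : LTree α} {ρ : LTree Q} {q : Q} (hρ : A.IsRunFrom q t ρ) {w : Node}
    (h₀ : t.subtree (w ++ [false]) ∈ A.reachCondition.lfp L (ρ (w ++ [false]), false))
    (h₁ : t.subtree (w ++ [true]) ∈ A.reachCondition.lfp L (ρ (w ++ [true]), false)) (b : Bool) :
    t.subtree w ∈ A.reachCondition.lfp L (ρ w, b) := by
  refine A.mono_reachCondition.step_lfp_subset _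
    (Or.inr ⟨ρ (w ++ [false]), ρ (w ++ [true]), ?_, ?_, ?_⟩)
  · simpa only [LTree.subtree_apply_nil] using hρ.2 w
  · simpa only [Set.mem_ofPred_eq, LTree.subtree_subtree] using h₀
  · simpa only [Set.mem_ofPred_eq, LTree.subtree_subtree] using h₁

theorem accept_lfp_reachCondition [Finite Q] {A : ParityTreeAutomaton α Q} {L : Q → Set (LTree α)}
    {t : LTree α} {q : Q} (hr : A.rank q = 2) (ht : t ∈ L q) :
    t ∈ A.reachCondition.lfp L (q, false) :=
  A.mono_reachCondition.step_lfp_subset _ (Or.inl ⟨rfl, hr, ht⟩)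

theorem mem_lfp_reachCondition_of_cut [Finite Q] {A : ParityTreeAutomaton α Q}
    {L : Q → Set (LTree α)} {t : LTree α} {ρ : LTree Q} {q : Q} (hρ : A.IsRunFrom q t ρ)
    {Y : Set Node} (hY : IsCut Y) (hr : ∀ v ∈ Y, A.rank (ρ v) = 2)
    (hL : ∀ v ∈ Y, t.subtree v ∈ L (ρ v)) {w : Node} (hw : ∀ y ∈ Y, ¬ y <+: w) :
    t.subtree w ∈ A.reachCondition.lfp L (ρ w, true) := by
  obtain ⟨N, hN⟩ := (hY.1.image List.length).bddAbove
  -- Induction on the distance to depth `N`, which bounds the cut. At distance zero a node not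
  -- strictly below the cut lies on it.
  have key : ∀ m (v : Node), N - v.length = m → (∀ y ∈ Y, y <+: v → y = v) →
      t.subtree v ∈ A.reachCondition.lfp L (ρ v, false) := by
    intro m
    induction m with
    | zero =>
      intro v hm hv
      obtain ⟨y, hy, h⟩ := hY.exists_comparable v
      have hyv : y = v := by
        rcases h with h | h
        · exact hv y hy h
        · have := hN ⟨y, hy, rfl⟩
          exact (h.eq_of_length (h.length_le.antisymm (by omega))).symm
      subst hyv
      exact accept_lfp_reachCondition (hr y hy) (hL y hy)
    | succ m ih =>
      intro v hm hv
      by_cases hvY : v ∈ Y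
      · exact accept_lfp_reachCondition (hr v hvY) (hL v hvY)
      · have hchild : ∀ b, ∀ y ∈ Y, y <+: v ++ [b] → y = v ++ [b] := by
          intro b y hy h
          refine (List.prefix_concat_iff.1 h).resolve_right fun h' => hvY ?_
          exact hv y hy h' ▸ hy
        exact step_lfp_reachCondition hρ (ih _ (by simp; omega) (hchild false))
          (ih _ (by simp; omega) (hchild true)) false
  have hchild : ∀ b, ∀ y ∈ Y, y <+: w ++ [b] → y = w ++ [b] := fun b y hy h =>
    (List.prefix_concat_iff.1 h).resolve_right (hw y hy)
  exact step_lfp_reachCondition hρ (key _ _ rfl (hchild false)) (key _ _ rfl (hchild true)) true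

theorem exists_run_of_mem_cutLanguage {A : ParityTreeAutomaton α Q} (n : ℕ) (q : Q) :
    ∀ t ∈ A.cutLanguage n q, ∃ ρ, A.IsRunFrom q t ρ := by
  intro t ht
  cases n with
  | zero => exact ht
  | succ n =>
    obtain ⟨ρ, hρ, -⟩ := ht
    exact ⟨ρ, hρ⟩

/-- The trees from which `q` can strictly reach a cut of states of rank `2` whose subtrees belong
to the corresponding languages `K^n`. -/
def reachLanguage (A : ParityTreeAutomaton α Q) (n : ℕ) (q : Q) : Set (LTree α) :=
  A.reachCondition.lfp (A.cutLanguage n) (q, true)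

/-- Cuts at the levels of the tree already test every node; conversely, the cuts reached from the
nodes of `X` are grafted together and the run is replaced below `X`. -/
theorem cutLanguage_succ_eq [Finite Q] (A : ParityTreeAutomaton α Q) (n : ℕ) (q : Q) :
    A.cutLanguage (n + 1) q =
      {t | ∃ ρ : LTree Q, A.IsRunFrom q t ρ ∧ ∀ w, t.subtree w ∈ A.reachLanguage n (ρ w)} := by
  ext t
  constructor
  · rintro ⟨ρ, hρ, hcut⟩
    refine ⟨ρ, hρ, fun w => ?_⟩
    -- On the level of `w`, the new run still agrees with `ρ` at `w`, and no node of `Y` is a prefix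
    -- of `w`.
    obtain ⟨Y, ρ', hY, hbelow, hρ', heq, hr, hL⟩ := hcut _ (isCut_level w.length)
    rw [← heq w rfl w (List.prefix_refl w)]
    refine mem_lfp_reachCondition_of_cut hρ' hY hr hL fun y hy hyw => ?_
    obtain ⟨x, hx, hxy, hne⟩ := hbelow y hy
    have := hxy.length_le
    have := hyw.length_le
    exact hne (hxy.eq_of_length (by rw [Set.mem_ofPred_eq] at hx; omega))
  · rintro ⟨ρ, hρ, hreach⟩
    refine ⟨ρ, hρ, fun X hX => ?_⟩
    have hc : ∀ x ∈ X, ∃ (Y : Set Node) (σ : LTree Q), IsCut Y ∧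
        A.IsRunFrom (ρ x) (t.subtree x) σ ∧ (∀ v ∈ Y, A.rank (σ v) = 2) ∧
        (∀ v ∈ Y, (t.subtree x).subtree v ∈ A.cutLanguage n (σ v)) ∧ [] ∉ Y := by
      intro x _
      obtain ⟨k, hk⟩ := Set.mem_iUnion.1 (hreach x)
      obtain ⟨Y, σ, h₁, h₂, h₃, h₄, h₅⟩ :=
        exists_cut_of_mem_lfpApprox (exists_run_of_mem_cutLanguage n) k _ _ hk
      exact ⟨Y, σ, h₁, h₂, h₃, h₄, h₅ rfl⟩
    have : Nonempty (LTree Q) := ⟨ρ⟩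
    choose! Y σ hY hσ hr hL hne using hc
    obtain ⟨ρ', hρ', heq, hglue⟩ :=
      exists_glued_run hX.antichain hρ.1 (fun w _ => hρ.2 w) hσ
    refine ⟨_, ρ', hX.bind hY, ?_, hρ', fun x hx w hwx => heq w fun x' hx' hx'w => ?_, ?_, ?_⟩
    · rintro _ ⟨x, hx, u, hu, rfl⟩
      refine ⟨x, hx, List.prefix_append x u, fun h => hne x hx ?_⟩
      rwa [List.self_eq_append_right.1 h] at hu
    · have := hX.antichain.eq hx' hx (hx'w.trans hwx)
      subst this
      exact hx'w.eq_of_length (hx'w.length_le.antisymm hwx.length_le)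
    · rintro _ ⟨x, hx, u, hu, rfl⟩
      rw [hglue x hx]
      exact hr x hx u hu
    · rintro _ ⟨x, hx, u, hu, rfl⟩
      rw [hglue x hx, ← LTree.subtree_subtree]
      exact hL x hx u hu

theorem cutLanguage_zero_eq_gfp [Finite Q] (A : ParityTreeAutomaton α Q) :
    A.cutLanguage 0 = A.safeCondition.gfp fun _ => Set.univ := by
  funext q
  rw [gfp_safeCondition]
  ext t
  simp [cutLanguage]

theorem cutLanguage_succ_eq_gfp [Finite Q] (A : ParityTreeAutomaton α Q) (n : ℕ) :
    A.cutLanguage (n + 1) = A.safeCondition.gfp (A.reachLanguage n) := by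
  funext q
  rw [gfp_safeCondition, cutLanguage_succ_eq]

/-- The family and its complements are carried through the induction together: duality swaps least
and greatest fixed points, and annotatability is closed under both. -/
theorem annotatable_cutLanguage [Finite Q] (A : ParityTreeAutomaton α Q) (n : ℕ) :
    Annotatable (A.cutLanguage n) ∧ Annotatable fun q => (A.cutLanguage n q)ᶜ := by
  induction n with
  | zero =>
    rw [cutLanguage_zero_eq_gfp]
    simp only [LocalCondition.compl_gfp, Set.compl_univ]
    exact ⟨annotatable_const_univ.gfp A.mono_safeCondition,
      annotatable_const_empty.lfp A.mono_safeCondition.dual⟩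
  | succ n ih =>
    have h₁ : Annotatable (A.reachLanguage n) :=
      (ih.1.lfp A.mono_reachCondition).comp fun q => (q, true)
    have h₂ : Annotatable fun q => (A.reachLanguage n q)ᶜ := by
      simp only [reachLanguage, LocalCondition.compl_lfp]
      exact (ih.2.gfp A.mono_reachCondition.dual).comp fun q => (q, true)
    rw [cutLanguage_succ_eq_gfp]
    simp only [LocalCondition.compl_gfp]
    exact ⟨h₁.gfp A.mono_safeCondition, h₂.lfp A.mono_safeCondition.dual⟩

/-! ### Accepting runs -/

/-- The trees that admit a run from `q` with infinitely many states of rank `2` on every path. -/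
def recurrentLanguage (A : ParityTreeAutomaton α Q) (q : Q) : Set (LTree α) :=
  {t | ∃ ρ : LTree Q, A.IsRunFrom q t ρ ∧ RecurrentOnPaths fun w => A.rank (ρ w) = 2}

theorem IsBuchi.language_eq {A : ParityTreeAutomaton α Q} (hA : A.IsBuchi) :
    A.language = A.recurrentLanguage A.init := by
  ext t
  simp only [language, recurrentLanguage, hA.forall_isAcceptingPath_iff]

theorem recurrentLanguage_subset_cutLanguage [Finite Q] (A : ParityTreeAutomaton α Q) (n : ℕ)
    (q : Q) : A.recurrentLanguage q ⊆ A.cutLanguage n q := by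
  induction n generalizing q with
  | zero =>
    rintro t ⟨ρ, hρ, -⟩
    exact ⟨ρ, hρ⟩
  | succ n ih =>
    rintro t ⟨ρ, hρ, hrec⟩
    rw [cutLanguage_succ_eq]
    refine ⟨ρ, hρ, fun w => ?_⟩
    have key : ∀ w, t.subtree w ∈ A.reachCondition.lfp (A.cutLanguage n) (ρ w, false) :=
      hrec.induction (fun w hw => accept_lfp_reachCondition hw
        (ih _ ⟨ρ.subtree w, hρ.subtree w, hrec.append w⟩))
        fun w h₀ h₁ => step_lfp_reachCondition hρ h₀ h₁ false
    exact step_lfp_reachCondition hρ (key _) (key _) true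

theorem cutLanguage_succ_subset (A : ParityTreeAutomaton α Q) (n : ℕ) (q : Q) :
    A.cutLanguage (n + 1) q ⊆ A.cutLanguage n q := by
  induction n generalizing q with
  | zero =>
    rintro t ⟨ρ, hρ, -⟩
    exact ⟨ρ, hρ⟩
  | succ n ih =>
    rintro t ⟨ρ, hρ, h⟩
    refine ⟨ρ, hρ, fun X hX => ?_⟩
    obtain ⟨Y, ρ', h₁, h₂, h₃, h₄, h₅, h₆⟩ := h X hX
    exact ⟨Y, ρ', h₁, h₂, h₃, h₄, h₅, fun v hv => ih _ (h₆ v hv)⟩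

theorem cutLanguage_antitone (A : ParityTreeAutomaton α Q) (q : Q) :
    Antitone fun n => A.cutLanguage n q :=
  antitone_nat_of_succ_le fun n => A.cutLanguage_succ_subset n q

end ParityTreeAutomaton


/-! ### Disjointness -/

namespace ParityTreeAutomaton

universe u v
variable {α : Type u} {QA QB : Type*}

/-- One step, in the direction `b`, of a play that alternately waits for an accepting state of a
second automaton (value `none`, the position being the root of a fixed run `s`) and for an accepting
state of the first one, with a decreasing bound `k` on the waiting time (value `some k`). -/
def WaitingStep (b : Bool) (hA hB : Prop) : Option ℕ → Option ℕ → LTree QB → LTree QB → Prop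
  | none, o', s, s' => hB ∧ o' ≠ none ∨ ¬ hB ∧ o' = none ∧ s' = s.subtree [b]
  | some k, o', _, _ => (∃ k' < k, o' = some k') ∨ hA ∧ (hB ∨ o' = none)

/-- Neither phase lasts forever: in `none` a fixed recurrent run is followed until it accepts, and
in `some k` the counter falls until `hA` holds. A step where both accept may skip the `none` phase,
hence the second alternative in `hsome`. -/
theorem frequently_of_waitingStep {p : ℕ → Bool} {hA : ℕ → Prop} {acc : QB → Prop}
    {o : ℕ → Option ℕ} {s : ℕ → LTree QB}
    (hs : ∀ m, RecurrentOnPaths fun w => acc (s m w))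
    (h : ∀ m, WaitingStep (p m) (hA m) (acc (s m [])) (o m) (o (m + 1)) (s m) (s (m + 1))) :
    (∃ᶠ m in atTop, hA m) ∧ ∃ᶠ m in atTop, acc (s m []) := by
  have hnone : ∀ N, ∃ m, N ≤ m ∧ o m ≠ none := by
    intro N
    by_contra! hcon
    have hstep : ∀ m, N ≤ m → ¬ acc (s m []) ∧ s (m + 1) = (s m).subtree [p m] := by
      intro m hm
      have := h m
      rw [hcon m hm, hcon (m + 1) (by omega)] at this
      rcases this with ⟨-, h'⟩ | ⟨h₁, -, h₂⟩
      · exact absurd rfl h'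
      · exact ⟨h₁, h₂⟩
    have heq : ∀ j, s (N + j) = (s N).subtree (pathNode (fun j => p (N + j)) j) := by
      intro j
      induction j with
      | zero => rfl
      | succ j ih =>
        rw [← add_assoc, (hstep _ (Nat.le_add_right _ _)).2, ih, LTree.subtree_subtree,
          pathNode_succ]
    obtain ⟨j, hj⟩ := (hs N fun j => p (N + j)).exists
    refine (hstep (N + j) (Nat.le_add_right _ _)).1 ?_
    rwa [heq, LTree.subtree_apply_nil]
  have hsome : ∀ N, ∃ m, N ≤ m ∧ (o m = none ∨ hA m ∧ acc (s m [])) := by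
    intro N
    by_contra! hcon
    have hdec : ∀ j k, o N = some k → ∃ k', o (N + j) = some k' ∧ k' + j ≤ k := by
      intro j k hk
      induction j with
      | zero => exact ⟨k, hk, le_rfl⟩
      | succ j ih =>
        obtain ⟨k', hk', hle⟩ := ih
        have := h (N + j)
        rw [hk'] at this
        rcases this with ⟨k'', hlt, hk''⟩ | ⟨hAm, hBm | hn⟩
        · exact ⟨k'', hk'', by omega⟩
        · exact absurd hBm ((hcon _ (Nat.le_add_right _ _)).2 hAm)
        · exact absurd hn (hcon (N + j + 1) (by omega)).1
    obtain ⟨k, hk⟩ := Option.ne_none_iff_exists'.1 (hcon N le_rfl).1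
    obtain ⟨k', -, hle⟩ := hdec (k + 1) k hk
    omega
  constructor
  · rw [frequently_atTop]
    intro N
    by_contra! hcon
    obtain ⟨m, hm, hom⟩ := hnone N
    have hstay : ∀ j, o (m + j) ≠ none := by
      intro j
      induction j with
      | zero => exact hom
      | succ j ih =>
        obtain ⟨k, hk⟩ := Option.ne_none_iff_exists'.1 ih
        have := h (m + j)
        rw [hk] at this
        rcases this with ⟨k', -, hk'⟩ | ⟨hAm, -⟩
        · rw [← add_assoc, hk']
          exact Option.some_ne_none _
        · exact absurd hAm (hcon _ (by omega))
    obtain ⟨m', hm', h' | ⟨h', -⟩⟩ := hsome m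
    · obtain ⟨j, rfl⟩ := Nat.exists_eq_add_of_le hm'
      exact hstay j h'
    · exact hcon m' (hm.trans hm') h'
  · rw [frequently_atTop]
    intro N
    by_contra! hcon
    obtain ⟨m, hm, h' | ⟨-, h'⟩⟩ := hsome N
    · have hstay : ∀ j, o (m + j) = none := by
        intro j
        induction j with
        | zero => exact h'
        | succ j ih =>
          have := h (m + j)
          rw [ih] at this
          rcases this with ⟨hBm, -⟩ | ⟨-, hn, -⟩
          · exact absurd hBm (hcon _ (by omega))
          · exact hn
      obtain ⟨m', hm', hne⟩ := hnone m
      obtain ⟨j, rfl⟩ := Nat.exists_eq_add_of_le hm'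
      exact hne (hstay j)
    · exact hcon m hm h'

/-- The pairs of states of `A` and `B` such that some tree belongs to `K^n` for the first one and
admits an accepting run from the second one. -/
def compatiblePairs (A : ParityTreeAutomaton α QA) (B : ParityTreeAutomaton α QB) (n : ℕ) :
    Set (QA × QB) :=
  {x | (A.cutLanguage n x.1 ∩ B.recurrentLanguage x.2).Nonempty}

theorem compatiblePairs_antitone (A : ParityTreeAutomaton α QA) (B : ParityTreeAutomaton α QB) :
    Antitone (A.compatiblePairs B) :=
  fun _ _ hmn _ hx => hx.mono (Set.inter_subset_inter_left _ (A.cutLanguage_antitone _ hmn))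

/-- The positions `(t, r, s, o)` of the play that builds a common tree: `s` is an accepting run of
`B` on `t`; for `o = none`, `r` is a run of `A` witnessing that `t` is in `K^(n+1)`; for
`o = some k`, only the root of `r` matters, which reaches a cut of `A` within `k` steps. -/
def IsPosition (A : ParityTreeAutomaton α QA) (B : ParityTreeAutomaton α QB) (n : ℕ)
    (x : LTree α × LTree QA × LTree QB × Option ℕ) : Prop :=
  B.IsRunFrom (x.2.2.1 []) x.1 x.2.2.1 ∧ (RecurrentOnPaths fun w => B.rank (x.2.2.1 w) = 2) ∧
    match x.2.2.2 with
    | none => A.IsRunFrom (x.2.1 []) x.1 x.2.1 ∧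
        ∀ w, x.1.subtree w ∈ A.reachLanguage n (x.2.1 w)
    | some k => x.1 ∈ A.reachCondition.lfpApprox (A.cutLanguage n) k (x.2.1 [], false)

/-- Simultaneous transitions of `A` and `B` between positions. -/
def JointTransition (A : ParityTreeAutomaton α QA) (B : ParityTreeAutomaton α QB)
    (q : QA) (p : QB) (y z : LTree α × LTree QA × LTree QB × Option ℕ) : Prop :=
  ∃ a, (q, a, y.2.1 [], z.2.1 []) ∈ A.trans ∧ (p, a, y.2.2.1 [], z.2.2.1 []) ∈ B.trans

variable {A : ParityTreeAutomaton α QA} {B : ParityTreeAutomaton α QB} {n : ℕ}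

theorem IsRunFrom.recurrent_subtree {t : LTree α} {s : LTree QB}
    (hs : B.IsRunFrom (s []) t s) (hrec : RecurrentOnPaths fun w => B.rank (s w) = 2) (v : Node) :
    B.IsRunFrom (s.subtree v []) (t.subtree v) (s.subtree v) ∧
      RecurrentOnPaths fun w => B.rank (s.subtree v w) = 2 :=
  ⟨by simpa only [LTree.subtree_apply_nil] using hs.subtree v, hrec.append v⟩

theorem exists_next_of_lfpApprox {t : LTree α} {s : LTree QB} {f : QA × Bool} {k : ℕ}
    (hs : B.IsRunFrom (s []) t s) (hrec : RecurrentOnPaths fun w => B.rank (s w) = 2)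
    (h : ∃ x y, (f.1, t [], x, y) ∈ A.trans ∧
      t.subtree [false] ∈ A.reachCondition.lfpApprox (A.cutLanguage n) k (x, false) ∧
      t.subtree [true] ∈ A.reachCondition.lfpApprox (A.cutLanguage n) k (y, false)) :
    ∃ y z, A.IsPosition B n y ∧ A.IsPosition B n z ∧ A.JointTransition B f.1 (s []) y z ∧
      y.2.2.2 = some k ∧ z.2.2.2 = some k := by
  obtain ⟨x, y, htr, hx, hy⟩ := h
  -- In counter mode only the root of the labelling for `A` is used, so a constant one suffices.
  refine ⟨(t.subtree [false], fun _ => x, s.subtree [false], some k),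
    (t.subtree [true], fun _ => y, s.subtree [true], some k), ?_, ?_, ?_, rfl, rfl⟩
  · exact ⟨(hs.recurrent_subtree hrec _).1, (hs.recurrent_subtree hrec _).2, hx⟩
  · exact ⟨(hs.recurrent_subtree hrec _).1, (hs.recurrent_subtree hrec _).2, hy⟩
  · exact ⟨t [], htr, by simpa only [LTree.subtree_apply_nil, List.nil_append] using hs.2 []⟩

theorem exists_next_of_run {t : LTree α} {r : LTree QA} {s : LTree QB}
    (hs : B.IsRunFrom (s []) t s) (hrec : RecurrentOnPaths fun w => B.rank (s w) = 2)
    (hr : A.IsRunFrom (r []) t r) (hreach : ∀ w, t.subtree w ∈ A.reachLanguage n (r w)) :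
    ∃ y z, A.IsPosition B n y ∧ A.IsPosition B n z ∧ A.JointTransition B (r []) (s []) y z ∧
      (B.rank (s []) = 2 ∧ y.2.2.2 ≠ none ∧ z.2.2.2 ≠ none ∨
        B.rank (s []) ≠ 2 ∧ (y.2.2.2 = none ∧ y.2.2.1 = s.subtree [false]) ∧
          z.2.2.2 = none ∧ z.2.2.1 = s.subtree [true]) := by
  by_cases hB : B.rank (s []) = 2
  · obtain ⟨k, hk⟩ := Set.mem_iUnion.1 (hreach [])
    cases k with
    | zero => exact hk.elim
    | succ k =>
      obtain ⟨y, z, hy, hz, hyz, hyk, hzk⟩ :=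
        -- The flag `true` rules out stopping at the root, which leaves a transition to children in
        -- counter mode.
        exists_next_of_lfpApprox hs hrec (f := (r [], true)) (k := k)
          (hk.resolve_left fun h => absurd h.1 (by simp))
      exact ⟨y, z, hy, hz, hyz, Or.inl ⟨hB, by simp [hyk], by simp [hzk]⟩⟩
  · have hpos : ∀ b, A.IsPosition B n (t.subtree [b], r.subtree [b], s.subtree [b], none) := by
      refine fun b => ⟨(hs.recurrent_subtree hrec _).1, (hs.recurrent_subtree hrec _).2, ?_, ?_⟩
      · simpa only [LTree.subtree_apply_nil] using hr.subtree [b]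
      · intro w
        rw [LTree.subtree_subtree]
        exact hreach _
    refine ⟨_, _, hpos false, hpos true, ⟨t [], ?_, ?_⟩, Or.inr ⟨hB, ⟨rfl, rfl⟩, rfl, rfl⟩⟩
    · simpa only [LTree.subtree_apply_nil, List.nil_append] using hr.2 []
    · simpa only [LTree.subtree_apply_nil, List.nil_append] using hs.2 []

/-- The delicate case is a counter position whose root lies on the cut: there `hn` supplies a new
tree, in K^{n+1} for the same state of `A`, with an accepting run of `B` from the same state. -/
theorem IsPosition.exists_next [Finite QA]
    (hn : A.compatiblePairs B n ⊆ A.compatiblePairs B (n + 1))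
    {x : LTree α × LTree QA × LTree QB × Option ℕ} (hx : A.IsPosition B n x) :
    ∃ y z, A.IsPosition B n y ∧ A.IsPosition B n z ∧
      (A.JointTransition B (x.2.1 []) (x.2.2.1 []) y z ∧
        WaitingStep false (A.rank (x.2.1 []) = 2) (B.rank (x.2.2.1 []) = 2) x.2.2.2 y.2.2.2
          x.2.2.1 y.2.2.1 ∧
        WaitingStep true (A.rank (x.2.1 []) = 2) (B.rank (x.2.2.1 []) = 2) x.2.2.2 z.2.2.2
          x.2.2.1 z.2.2.1) := by
  obtain ⟨t, r, s, o⟩ := x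
  obtain ⟨hs, hrec, ho⟩ := hx
  cases o with
  | none =>
    obtain ⟨y, z, hy, hz, hyz, h⟩ := exists_next_of_run hs hrec ho.1 ho.2
    refine ⟨y, z, hy, hz, hyz, ?_⟩
    rcases h with ⟨hB, h₀, h₁⟩ | ⟨hB, h₀, h₁⟩
    · exact ⟨Or.inl ⟨hB, h₀⟩, Or.inl ⟨hB, h₁⟩⟩
    · exact ⟨Or.inr ⟨hB, h₀⟩, Or.inr ⟨hB, h₁⟩⟩
  | some k =>
    cases k with
    | zero => exact ho.elim
    | succ k =>
      rcases ho with ⟨-, hA, ht⟩ | h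
      · obtain ⟨t', ht', s', hs', hrec'⟩ := hn (a := (r [], s [])) ⟨t, ht, s, hs, hrec⟩
        rw [cutLanguage_succ_eq] at ht'
        obtain ⟨r', hr', hreach⟩ := ht'
        have er : r' [] = r [] := hr'.1
        have es : s' [] = s [] := hs'.1
        obtain ⟨y, z, hy, hz, hyz, h⟩ :=
          exists_next_of_run (es ▸ hs') hrec' (er ▸ hr') hreach
        rw [er, es] at hyz
        rw [es] at h
        refine ⟨y, z, hy, hz, hyz, Or.inr ⟨hA, ?_⟩, Or.inr ⟨hA, ?_⟩⟩
        · exact h.imp (fun h => h.1) fun h => h.2.1.1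
        · exact h.imp (fun h => h.1) fun h => h.2.2.1
      · obtain ⟨y, z, hy, hz, hyz, hyk, hzk⟩ :=
          exists_next_of_lfpApprox hs hrec (f := (r [], false)) h
        exact ⟨y, z, hy, hz, hyz, Or.inl ⟨k, k.lt_succ_self, hyk⟩,
          Or.inl ⟨k, k.lt_succ_self, hzk⟩⟩

/-- The witness is a new tree: its letters are those of the joint transitions, read from trees that
are exchanged along the way. -/
theorem exists_mem_inter_of_compatiblePairs_subset [Finite QA]
    (hn : A.compatiblePairs B n ⊆ A.compatiblePairs B (n + 1)) {q : QA} {p : QB}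
    (hqp : (q, p) ∈ A.compatiblePairs B n) :
    (A.recurrentLanguage q ∩ B.recurrentLanguage p).Nonempty := by
  obtain ⟨t, ht, s, hs, hrec⟩ := hn hqp
  rw [cutLanguage_succ_eq] at ht
  obtain ⟨r, hr, hreach⟩ := ht
  obtain rfl : r [] = q := hr.1
  obtain rfl : s [] = p := hs.1
  have h₀ : A.IsPosition B n (t, r, s, none) := ⟨hs, hrec, hr, hreach⟩
  obtain ⟨c, hc₀, hInv, hc⟩ := exists_labelling_of_step (Inv := fun _ => A.IsPosition B n) h₀
    fun w x hx => hx.exists_next hn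
  choose a haA haB using fun w => (hc w).1
  have key : ∀ d : ℕ → Bool,
      (∃ᶠ m in atTop, A.rank ((c (pathNode d m)).2.1 []) = 2) ∧
      ∃ᶠ m in atTop, B.rank ((c (pathNode d m)).2.2.1 []) = 2 := by
    intro d
    refine frequently_of_waitingStep (p := d) (acc := fun p => B.rank p = 2)
      (o := fun m => (c (pathNode d m)).2.2.2) (s := fun m => (c (pathNode d m)).2.2.1)
      (fun m => (hInv _).2.1) fun m => ?_
    simp only [pathNode_succ]
    cases d m
    · exact (hc _).2.1
    · exact (hc _).2.2
  refine ⟨a, ⟨fun w => (c w).2.1 [], ⟨?_, haA⟩, fun d => (key d).1⟩,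
    fun w => (c w).2.2.1 [], ⟨?_, haB⟩, fun d => (key d).2⟩
  · exact congrArg (fun x => x.2.1 []) hc₀
  · exact congrArg (fun x => x.2.2.1 []) hc₀

/-- A strict decrease at every stage would remove at least one pair each time, more often than there
are pairs. -/
theorem exists_compatiblePairs_subset [Finite QA] [Finite QB] (A : ParityTreeAutomaton α QA)
    (B : ParityTreeAutomaton α QB) {M : ℕ} (hM : Nat.card QA * Nat.card QB < M) :
    ∃ n ≤ M, A.compatiblePairs B n ⊆ A.compatiblePairs B (n + 1) := by
  by_contra! hcon
  have hcard : ∀ n ≤ M, (A.compatiblePairs B n).ncard + n ≤ Nat.card QA * Nat.card QB := by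
    intro n hn
    induction n with
    | zero =>
      rw [← Nat.card_prod]
      exact Set.ncard_le_card _
    | succ n ih =>
      have := Set.ncard_lt_ncard
        ⟨A.compatiblePairs_antitone B (Nat.le_add_right n 1), hcon n (by omega)⟩ (Set.toFinite _)
      have := ih (by omega)
      omega
  have := hcard M le_rfl
  omega

theorem disjoint_cutLanguage [Finite QA] [Finite QB] {q : QA} {p : QB}
    (h : Disjoint (A.recurrentLanguage q) (B.recurrentLanguage p)) {M : ℕ}
    (hM : Nat.card QA * Nat.card QB < M) :
    Disjoint (A.cutLanguage M q) (B.recurrentLanguage p) := by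
  obtain ⟨n, hn, hsub⟩ := exists_compatiblePairs_subset A B hM
  rw [Set.disjoint_iff_inter_eq_empty, ← Set.not_nonempty_iff_eq_empty]
  intro hne
  have hqp : (q, p) ∈ A.compatiblePairs B n := A.compatiblePairs_antitone B hn hne
  exact Set.not_nonempty_iff_eq_empty.2 (Set.disjoint_iff_inter_eq_empty.1 h)
    (exists_mem_inter_of_compatiblePairs_subset hsub hqp)

theorem separates_cutLanguage [Finite QA] [Finite QB] (hA : A.IsBuchi) (hB : B.IsBuchi)
    (h : Disjoint A.language B.language) {M : ℕ} (hM : Nat.card QA * Nat.card QB < M) :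
    IsBuchiLanguage (A.cutLanguage M A.init) ∧ IsCoBuchiLanguage (A.cutLanguage M A.init) ∧
      Separates (A.cutLanguage M A.init) A.language B.language := by
  rw [hA.language_eq, hB.language_eq] at *
  exact ⟨(A.annotatable_cutLanguage M).1.isBuchiLanguage _,
    (A.annotatable_cutLanguage M).2.isBuchiLanguage _,
    A.recurrentLanguage_subset_cutLanguage M _, disjoint_cutLanguage h hM⟩

end ParityTreeAutomaton

theorem mainTheorem4 {α : Type*} [Finite α] :
    HasFirstSeparationProperty {L : Set (LTree α) | IsBuchiLanguage L} ∧
    ∀ {QA QB : Type*} [Finite QA] [Finite QB]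
      (A : ParityTreeAutomaton α QA) (B : ParityTreeAutomaton α QB),
      A.IsBuchi → B.IsBuchi → Disjoint A.language B.language →
      IsBuchiLanguage (A.cutLanguage (2 ^ (Nat.card QA * Nat.card QB) + 1) A.init) ∧
      IsCoBuchiLanguage (A.cutLanguage (2 ^ (Nat.card QA * Nat.card QB) + 1) A.init) ∧
      Separates (A.cutLanguage (2 ^ (Nat.card QA * Nat.card QB) + 1) A.init)
        A.language B.language := by
  -- More stages than pairs of states suffice, so the exponential bound leaves room to spare.
  have key : ∀ k : ℕ, k < 2 ^ k + 1 := fun k => Nat.lt_succ_of_lt Nat.lt_two_pow_self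
  refine ⟨?_, fun {QA QB} _ _ A B hA hB h => A.separates_cutLanguage hA hB h (key _)⟩
  rintro _ ⟨QA, _, A, hA, rfl⟩ _ ⟨QB, _, B, hB, rfl⟩ h
  exact ⟨_, A.separates_cutLanguage hA hB h (key _)⟩
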